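/- Let $a,b>0$ and $m\in\mathbb R$, and let $X_1,X_2,\dots$ be i.i.d. random variables with the symmetric variance-gamma distribution with location $m$, shape $a$ and scale $b$, that is, with the law of $m+\sqrt{bG}\,Z$, where $G\sim\Gamma(a,1)$ and $Z\sim\mathcal N(0,1)$ are independent. For $N\ge 1$ let $$\overline X=\frac1N\sum_{i=1}^N X_i,\qquad \hat V=\frac1N\sum_{i=1}^N (X_i-\overline X)^2,\qquad \hat K=\frac1N\sum_{i=1}^N (X_i-\overline X)^4,$$ $$\hat a=\frac{3\hat V^2}{\hat K-3\hat V^2},\qquad \hat b=\frac{\hat K}{3\hat V}-\hat V .$$ Then the estimators $(\overline X,\hat a,\hat b)$ of $(m,a,b)$ are asymptotically normal with block diagonal limiting covariance matrix: as $N\to\infty$, $$\sqrt N\,\bigl[(\overline X,\hat a,\hat b)-(m,a,b)\bigr]\ \to_d\ \mathcal N_3\bigl(0,\ \mathrm{diag}(ab,\Sigma)\bigr),$$ where $$\Sigma=\frac13\begin{bmatrix}2(4a^4+36a^3+95a^2+63a) & -2(4a^3+36a^2+101a+69)\,b\\ -2(4a^3+36a^2+101a+69)\,b & (8a^2+72a+220+159a^{-1})\,b^2\end{bmatrix}.$$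 (The estimators may be given arbitrary values where a denominator vanishes; this has probability tending to $0$.) -/

import Mathlib

open MeasureTheory ProbabilityTheory Filter Topology

noncomputable section

namespace SVG

/-- The symmetric variance-gamma law with location `m`, shape `a` and scale `b`: the law of
`m + √(b G) Z`, where `G ∼ Γ(a, 1)` and `Z ∼ N(0, 1)` are independent. -/
def law (m a b : ℝ) : Measure ℝ :=
  ((gammaMeasure a 1).prod (gaussianReal 0 1)).map (fun p => m + √(b * p.1) * p.2)

/-- The empirical mean of `x 0, …, x (N - 1)`. -/
def mean (x : ℕ → ℝ) (N : ℕ) : ℝ :=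
  (∑ i ∈ Finset.range N, x i) / N

/-- The empirical centered moment of order two of `x 0, …, x (N - 1)`. -/
def vHat (x : ℕ → ℝ) (N : ℕ) : ℝ :=
  (∑ i ∈ Finset.range N, (x i - mean x N) ^ 2) / N

/-- The empirical centered moment of order four of `x 0, …, x (N - 1)`. -/
def kHat (x : ℕ → ℝ) (N : ℕ) : ℝ :=
  (∑ i ∈ Finset.range N, (x i - mean x N) ^ 4) / N

/-- The moment estimator of the shape parameter. -/
def aHat (x : ℕ → ℝ) (N : ℕ) : ℝ :=
  3 * vHat x N ^ 2 / (kHat x N - 3 * vHat x N ^ 2)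

/-- The moment estimator of the scale parameter. -/
def bHat (x : ℕ → ℝ) (N : ℕ) : ℝ :=
  kHat x N / (3 * vHat x N) - vHat x N

/-- The limiting covariance matrix of the moment estimators of `(a, b)`. -/
def sigma (a b : ℝ) : Matrix (Fin 2) (Fin 2) ℝ :=
  (1 / 3 : ℝ) •
    !![2 * (4 * a ^ 4 + 36 * a ^ 3 + 95 * a ^ 2 + 63 * a),
        -2 * (4 * a ^ 3 + 36 * a ^ 2 + 101 * a + 69) * b;
       -2 * (4 * a ^ 3 + 36 * a ^ 2 + 101 * a + 69) * b,
        (8 * a ^ 2 + 72 * a + 220 + 159 * a⁻¹) * b ^ 2]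

/-- The block diagonal matrix `diag(ab, Σ)`. -/
def limitCov (a b : ℝ) : Matrix (Fin 3) (Fin 3) ℝ :=
  !![a * b, 0, 0;
     0, sigma a b 0 0, sigma a b 0 1;
     0, sigma a b 1 0, sigma a b 1 1]

end SVG

end

/-! The estimators are smooth functions of the empirical moments of orders one to four about `m`,
so the delta method reduces the theorem to the central limit theorem for `(Y, Y², Y³, Y⁴)`, where
`Y = X - m`. Conditioning on the Gamma variable gives `𝔼[Y ^ (2 * k)] = b ^ k (a)_k (2 k - 1)‼`
with `(a)_k` the rising factorial, and the odd moments vanish by symmetry. If `C` is the resulting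
covariance matrix and `J` is the Jacobian matrix of the estimators at the true moments, then
`J C Jᵀ = diag(ab, Σ)`. -/

open scoped Matrix

section ConvergenceInDistribution

variable {ι Ω Ω' E F : Type*} {mΩ : MeasurableSpace Ω} {mΩ' : MeasurableSpace Ω'}
  {P : Measure Ω} {P' : Measure Ω'} {l : Filter ι}

theorem tendstoInMeasure_comp_of_continuousAt [PseudoEMetricSpace E] [PseudoEMetricSpace F]
    {T : ι → Ω → E} {θ : E} {q : E → F} (hT : TendstoInMeasure P T l fun _ => θ)
    (hq : ContinuousAt q θ) : TendstoInMeasure P (fun i ω => q (T i ω)) l fun _ => q θ := by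
  intro ε hε
  obtain ⟨δ, hδ, hqδ⟩ := EMetric.tendsto_nhds_nhds.1 hq ε hε
  refine tendsto_of_tendsto_of_tendsto_of_le_of_le tendsto_const_nhds (hT δ hδ)
    (fun _ => zero_le) fun i => measure_mono fun ω hω => ?_
  contrapose! hω
  simpa using hqδ (by simpa using hω)

variable [IsProbabilityMeasure P] [IsProbabilityMeasure P']

theorem tendstoInMeasure_const_of_tendstoInDistribution [PseudoMetricSpace E]
    [MeasurableSpace E] [BorelSpace E] {X : ι → Ω → E} {c : E}
    (h : TendstoInDistribution X l (fun _ => c) (fun _ => P) P') :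
    TendstoInMeasure P X l fun _ => c := by
  refine tendstoInMeasure_iff_dist.2 fun ε hε => ?_
  have hclosed : IsClosed {x | ε ≤ dist x c} := isClosed_le continuous_const (by fun_prop)
  have hnull : (P'.map fun _ => c) {x | ε ≤ dist x c} = 0 := by
    simp [Measure.map_const, Measure.dirac_apply' _ hclosed.measurableSet, hε]
  have hlim := ProbabilityMeasure.tendsto_measure_of_null_frontier_of_tendsto' h.tendsto
    (measure_mono_null hclosed.frontier_subset hnull)
  simpa only [ProbabilityMeasure.coe_mk, hnull, Set.preimage_ofPred_eq,
    Measure.map_apply_of_aemeasurable (h.forall_aemeasurable _) hclosed.measurableSet] using hlim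

theorem tendstoInMeasure_smul_zero_of_tendstoInDistribution [l.IsCountablyGenerated]
    [NormedAddCommGroup E] [NormedSpace ℝ E] [MeasurableSpace E] [BorelSpace E]
    [SecondCountableTopology E] {X : ι → Ω → E} {Z : Ω' → E} {Y : ι → Ω → ℝ}
    (hX : TendstoInDistribution X l Z (fun _ => P) P')
    (hY : TendstoInMeasure P Y l fun _ => 0) (hYm : ∀ i, AEMeasurable (Y i) P) :
    TendstoInMeasure P (fun i ω => Y i ω • X i ω) l fun _ => 0 := by
  have h := hX.continuous_comp_prodMk_of_tendstoInMeasure_const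
    (g := fun p : E × ℝ => p.2 • p.1) (by fun_prop) hY hYm
  simp only [zero_smul] at h
  exact tendstoInMeasure_const_of_tendstoInDistribution h

theorem tendstoInDistribution_of_identDistrib_limit [TopologicalSpace E] [MeasurableSpace E]
    [OpensMeasurableSpace E] {Ω'' : Type*} {mΩ'' : MeasurableSpace Ω''} {P'' : Measure Ω''}
    [IsProbabilityMeasure P''] {X : ι → Ω → E} {Z : Ω' → E} {Z' : Ω'' → E}
    (h : TendstoInDistribution X l Z (fun _ => P) P') (hZ : IdentDistrib Z Z' P' P'') :
    TendstoInDistribution X l Z' (fun _ => P) P'' where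
  forall_aemeasurable := h.forall_aemeasurable
  aemeasurable_limit := hZ.aemeasurable_snd
  tendsto := by
    convert! h.tendsto using 2
    exact congrArg 𝓝 (Subtype.ext hZ.map_eq.symm)

section DeltaMethod

variable [l.IsCountablyGenerated]
  [NormedAddCommGroup E] [NormedSpace ℝ E] [MeasurableSpace E] [BorelSpace E]
  [SecondCountableTopology E] {T : ι → Ω → E} {θ : E} {Z : Ω' → E} {r : ι → ℝ}

theorem tendstoInMeasure_of_tendstoInDistribution_smul_sub (hr : Tendsto r l atTop)
    (h : TendstoInDistribution (fun i ω => r i • (T i ω - θ)) l Z (fun _ => P) P') :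
    TendstoInMeasure P T l fun _ => θ := by
  have hinv : TendstoInMeasure P (fun i (_ : Ω) => (r i)⁻¹) l fun _ => (0 : ℝ) := by
    refine tendstoInMeasure_iff_dist.2 fun ε hε => tendsto_const_nhds.congr' ?_
    filter_upwards [Metric.tendsto_nhds.1 hr.inv_tendsto_atTop ε hε] with i hi
    have hempty : {_ω : Ω | ε ≤ dist (r i)⁻¹ 0} = ∅ :=
      Set.eq_empty_of_forall_notMem fun _ => hi.not_ge
    rw [hempty, measure_empty]
  have hsub : TendstoInMeasure P (fun i ω => T i ω - θ) l fun _ => 0 := by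
    refine (tendstoInMeasure_smul_zero_of_tendstoInDistribution h hinv
      fun _ => aemeasurable_const).congr' ?_ .rfl
    filter_upwards [hr.eventually_ne_atTop 0] with i hi
    exact ae_of_all _ fun ω => inv_smul_smul₀ hi _
  simpa only [tendstoInMeasure_iff_norm, sub_zero] using hsub

variable [NormedAddCommGroup F] [NormedSpace ℝ F] [MeasurableSpace F] [BorelSpace F]
  [SecondCountableTopology F]

/-- The delta method: the remainder `R` of the linearization is `o(‖x - θ‖)`, so
`r i • R (T i)` is a factor tending to `0` in probability times a sequence converging in
distribution. -/
theorem tendstoInDistribution_smul_comp_sub (hr : Tendsto r l atTop)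
    (hT : ∀ i, AEMeasurable (T i) P)
    (h : TendstoInDistribution (fun i ω => r i • (T i ω - θ)) l Z (fun _ => P) P')
    {g : E → F} (hg : Measurable g) {g' : E →L[ℝ] F} (hg' : HasFDerivAt g g' θ) :
    TendstoInDistribution (fun i ω => r i • (g (T i ω) - g θ)) l (fun ω' => g' (Z ω'))
      (fun _ => P) P' := by
  let R : E → F := fun x => g x - g θ - g' (x - θ)
  let q : E → ℝ := fun x => ‖x - θ‖⁻¹ * ‖R x‖
  have hR : Measurable R := by fun_prop
  have hqT : TendstoInMeasure P (fun i ω => q (T i ω)) l fun _ => 0 := by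
    have hq : ContinuousAt q θ := by
      simpa [ContinuousAt, q, R, map_sub] using hasFDerivAt_iff_tendsto.1 hg'
    simpa [q] using tendstoInMeasure_comp_of_continuousAt
      (tendstoInMeasure_of_tendstoInDistribution_smul_sub hr h) hq
  have hrem : TendstoInMeasure P (fun i ω => r i • R (T i ω)) l fun _ => 0 := by
    have hqm : Measurable q := by fun_prop
    have hnorm (i : ι) (ω : Ω) :
        ‖q (T i ω) • r i • (T i ω - θ)‖ = ‖r i • R (T i ω)‖ := by
      rcases eq_or_ne (T i ω) θ with hω | hω
      · simp [q, R, hω]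
      · have : ‖T i ω - θ‖ ≠ 0 := norm_ne_zero_iff.2 (sub_ne_zero.2 hω)
        simp only [q, norm_smul, norm_mul, norm_inv, norm_norm]
        field_simp
    simpa only [tendstoInMeasure_iff_norm, sub_zero, hnorm] using
      tendstoInMeasure_smul_zero_of_tendstoInDistribution h hqT
        fun i => hqm.comp_aemeasurable (hT i)
  refine tendstoInDistribution_of_tendstoInMeasure_sub _ _ (h.continuous_comp g'.continuous) ?_
    fun i => ((hg.comp_aemeasurable (hT i)).sub_const _).const_smul _
  convert! hrem using 3
  simp [R, smul_sub]

end DeltaMethod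

end ConvergenceInDistribution

section CentralLimitTheorem

variable {Ω E : Type*} {mΩ : MeasurableSpace Ω} {P : Measure Ω}
  [NormedAddCommGroup E] [InnerProductSpace ℝ E] [FiniteDimensional ℝ E]
  [MeasurableSpace E] [BorelSpace E]

theorem charFun_map_eq_charFun_map_inner {X : Ω → E} (hX : AEMeasurable X P) (t : E) :
    charFun (P.map X) t = charFun (P.map fun ω => inner ℝ t (X ω)) 1 := by
  rw [charFun_apply, charFun_apply_real, integral_map hX (by fun_prop),
    integral_map (by fun_prop) (by fun_prop)]
  simp [real_inner_comm]

variable [IsProbabilityMeasure P]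

theorem tendstoInDistribution_of_forall_inner {Ω' : Type*} {mΩ' : MeasurableSpace Ω'}
    {P' : Measure Ω'} [IsProbabilityMeasure P'] {X : ℕ → Ω → E} {Z : Ω' → E}
    (hX : ∀ n, AEMeasurable (X n) P) (hZ : AEMeasurable Z P')
    (h : ∀ t : E, TendstoInDistribution (fun n ω => inner ℝ t (X n ω)) atTop
      (fun ω' => inner ℝ t (Z ω')) (fun _ => P) P') :
    TendstoInDistribution X atTop Z (fun _ => P) P' where
  forall_aemeasurable := hX
  aemeasurable_limit := hZ
  tendsto := ProbabilityMeasure.tendsto_iff_tendsto_charFun.2 fun t => by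
    simpa only [ProbabilityMeasure.coe_mk, charFun_map_eq_charFun_map_inner, hX, hZ] using
      ProbabilityMeasure.tendsto_iff_tendsto_charFun.1 (h t).tendsto 1

theorem variance_inner_eq_covarianceBilin_map {V : Ω → E} (hV : MemLp V 2 P) (t : E) :
    Var[fun ω => inner ℝ t (V ω); P] = covarianceBilin (P.map V) t t := by
  have hVm : AEMeasurable V P := hV.aestronglyMeasurable.aemeasurable
  have := Measure.isProbabilityMeasure_map hVm
  rw [covarianceBilin_self ((memLp_map_measure_iff (by fun_prop) hVm).2 hV),
    variance_map (by fun_prop) hVm]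
  rfl

theorem tendstoInDistribution_inv_sqrt_smul_sum_sub {W : ℕ → Ω → E}
    (hindep : iIndepFun W P) (hident : ∀ n, IdentDistrib (W n) (W 0) P P) (hW : MemLp (W 0) 2 P)
    {ν : Measure E} [IsGaussian ν] (hmean : ∫ x, x ∂ν = 0)
    (hcov : covarianceBilin ν = covarianceBilin (P.map (W 0))) :
    TendstoInDistribution
      (fun (n : ℕ) ω => (√(n : ℝ))⁻¹ • (∑ k ∈ Finset.range n, W k ω - (n : ℝ) • P[W 0]))
      atTop id (fun _ => P) ν := by
  have hWm (k : ℕ) : AEMeasurable (W k) P := (hident k).aemeasurable_fst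
  refine tendstoInDistribution_of_forall_inner (by fun_prop) (by fun_prop) fun t => ?_
  have hinner : Measurable fun x : E => inner ℝ t x := by fun_prop
  have hlaw : HasLaw (fun x => inner ℝ t x)
      (gaussianReal 0 Var[fun ω => inner ℝ t (W 0 ω); P].toNNReal) ν := by
    refine ⟨by fun_prop, (IsGaussian.map_eq_gaussianReal (innerSL ℝ t)).trans ?_⟩
    rw [variance_inner_eq_covarianceBilin_map hW, ← hcov,
      covarianceBilin_self IsGaussian.memLp_two_id,
      (innerSL ℝ t).integral_comp_id_comm IsGaussian.integrable_id, hmean, map_zero]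
    rfl
  refine (tendstoInDistribution_inv_sqrt_mul_sum_sub (X := fun n ω => inner ℝ t (W n ω)) hlaw
    (hW.const_inner t) (hindep.comp (fun _ x => inner ℝ t x) fun _ => hinner)
    fun n => (hident n).comp hinner).congr (fun n => ae_of_all _ fun ω => ?_) .rfl
  simp only [inner_smul_right, inner_sub_right, inner_sum,
    integral_inner (hW.integrable one_le_two)]

end CentralLimitTheorem

section CovarianceMatrix

variable {Ω ι κ : Type*} {mΩ : MeasurableSpace Ω} {P : Measure Ω}

/-- The covariance matrix of a random vector in `ℝ^ι`. -/
noncomputable def covarianceMatrix (V : Ω → EuclideanSpace ℝ ι) (P : Measure Ω) : Matrix ι ι ℝ :=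
  Matrix.of fun i j => cov[fun ω => V ω i, fun ω => V ω j; P]

theorem covarianceMatrix_apply (V : Ω → EuclideanSpace ℝ ι) (P : Measure Ω) (i j : ι) :
    covarianceMatrix V P i j = cov[fun ω => V ω i, fun ω => V ω j; P] :=
  rfl

variable [Fintype ι] [Fintype κ]

theorem covarianceBilin_map_eq_dotProduct_mulVec [IsFiniteMeasure P]
    {V : Ω → EuclideanSpace ℝ ι} (hV : MemLp V 2 P) (x y : EuclideanSpace ℝ ι) :
    covarianceBilin (P.map V) x y = x.ofLp ⬝ᵥ covarianceMatrix V P *ᵥ y.ofLp := by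
  refine (covarianceBilin_apply_pi hV.eval_piLp x y).trans ?_
  simp only [dotProduct, Matrix.mulVec, Finset.mul_sum, covarianceMatrix_apply]
  exact Finset.sum_congr rfl fun i _ => Finset.sum_congr rfl fun j _ => by ring

theorem posSemidef_covarianceMatrix [IsFiniteMeasure P] {V : Ω → EuclideanSpace ℝ ι}
    (hV : MemLp V 2 P) : (covarianceMatrix V P).PosSemidef := by
  refine .of_dotProduct_mulVec_nonneg ?_ fun x => ?_
  · ext i j
    exact covariance_comm _ _
  · simpa [covarianceBilin_map_eq_dotProduct_mulVec hV] using
      covarianceBilin_self_nonneg (μ := P.map V) (WithLp.toLp 2 x)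

variable [DecidableEq ι] [DecidableEq κ]

theorem map_toLpLin_multivariateGaussian {S : Matrix ι ι ℝ} (hS : S.PosSemidef)
    (μ : EuclideanSpace ℝ ι) (A : Matrix κ ι ℝ) :
    (multivariateGaussian μ S).map (Matrix.toLpLin 2 2 A).toContinuousLinearMap =
      multivariateGaussian (Matrix.toLpLin 2 2 A μ) (A * S * Aᵀ) := by
  have hAS : (A * S * Aᵀ).PosSemidef := by simpa using hS.mul_mul_conjTranspose_same A
  set L := (Matrix.toLpLin 2 2 A).toContinuousLinearMap
  have hadj (y : EuclideanSpace ℝ κ) : (L.adjoint y).ofLp = Aᵀ *ᵥ y.ofLp := by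
    have h := Matrix.toEuclideanLin_conjTranspose_eq_adjoint A
    exact congrArg WithLp.ofLp (LinearMap.congr_fun h y).symm
  refine IsGaussian.ext ?_ ?_
  · simp only [id_eq]
    rw [ContinuousLinearMap.integral_id_map IsGaussian.integrable_id,
      integral_id_multivariateGaussian, integral_id_multivariateGaussian]
    rfl
  · ext x y
    rw [covarianceBilin_map IsGaussian.memLp_two_id, covarianceBilin_multivariateGaussian hS,
      covarianceBilin_multivariateGaussian hAS, hadj, hadj, Matrix.mulVec_transpose,
      ← Matrix.mulVec_mulVec, ← Matrix.mulVec_mulVec, Matrix.dotProduct_mulVec x.ofLp]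

end CovarianceMatrix

section MethodOfMoments

theorem sqrt_smul_inv_smul_sub {E : Type*} [AddCommGroup E] [Module ℝ E] (n : ℕ) (s c : E) :
    √(n : ℝ) • ((n : ℝ)⁻¹ • s - c) = (√(n : ℝ))⁻¹ • (s - (n : ℝ) • c) := by
  have hinv : √(n : ℝ) * (n : ℝ)⁻¹ = (√(n : ℝ))⁻¹ := by
    rw [← div_eq_mul_inv, Real.sqrt_div_self]
  have hsqrt : (√(n : ℝ))⁻¹ * n = √(n : ℝ) := by
    rw [mul_comm, ← div_eq_mul_inv, Real.div_sqrt]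
  rw [smul_sub, smul_sub, smul_smul, smul_smul, hinv, hsqrt]

variable {Ω 𝓧 ι κ : Type*} {mΩ : MeasurableSpace Ω} {P : Measure Ω} [IsProbabilityMeasure P]
  {m𝓧 : MeasurableSpace 𝓧} {ν : Measure 𝓧} {X : ℕ → Ω → 𝓧} [Fintype ι] [DecidableEq ι]
  {φ : 𝓧 → EuclideanSpace ℝ ι}

theorem tendstoInDistribution_sqrt_smul_average_sub (hX : ∀ k, HasLaw (X k) ν P)
    (hindep : iIndepFun X P) (hφ : Measurable φ) (hφ2 : MemLp φ 2 ν) :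
    TendstoInDistribution
      (fun (n : ℕ) ω =>
        √(n : ℝ) • ((n : ℝ)⁻¹ • ∑ k ∈ Finset.range n, φ (X k ω) - ∫ x, φ x ∂ν))
      atTop id (fun _ => P) (multivariateGaussian 0 (covarianceMatrix φ ν)) := by
  have : IsProbabilityMeasure ν := (hX 0).isProbabilityMeasure_iff.1 inferInstance
  have hlaw (k : ℕ) : HasLaw (fun ω => φ (X k ω)) (ν.map φ) P :=
    HasLaw.fun_comp ⟨hφ.aemeasurable, rfl⟩ (hX k)
  have hW : MemLp (fun ω => φ (X 0 ω)) 2 P :=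
    ((hX 0).map_eq ▸ hφ2 : MemLp φ 2 (P.map (X 0))).comp_of_map (hX 0).aemeasurable
  have hmean : ∫ ω, φ (X 0 ω) ∂P = ∫ x, φ x ∂ν :=
    (hX 0).integral_comp hφ.aestronglyMeasurable
  have hcov : covarianceBilin (multivariateGaussian 0 (covarianceMatrix φ ν)) =
      covarianceBilin (P.map fun ω => φ (X 0 ω)) := by
    ext x y
    rw [(hlaw 0).map_eq, covarianceBilin_map_eq_dotProduct_mulVec hφ2,
      covarianceBilin_multivariateGaussian (posSemidef_covarianceMatrix hφ2)]
  simp only [sqrt_smul_inv_smul_sub, ← hmean]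
  exact tendstoInDistribution_inv_sqrt_smul_sum_sub (W := fun k ω => φ (X k ω))
    (hindep.comp (fun _ => φ) fun _ => hφ)
    (fun n => (hlaw n).identDistrib (hlaw 0)) hW integral_id_multivariateGaussian hcov

theorem tendstoInDistribution_sqrt_smul_comp_average_sub [Fintype κ] [DecidableEq κ]
    (hX : ∀ k, HasLaw (X k) ν P) (hindep : iIndepFun X P) (hφ : Measurable φ)
    (hφ2 : MemLp φ 2 ν) {g : EuclideanSpace ℝ ι → EuclideanSpace ℝ κ} (hg : Measurable g)
    {J : Matrix κ ι ℝ}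
    (hg' : HasFDerivAt g (Matrix.toLpLin 2 2 J).toContinuousLinearMap (∫ x, φ x ∂ν)) :
    TendstoInDistribution
      (fun (n : ℕ) ω =>
        √(n : ℝ) • (g ((n : ℝ)⁻¹ • ∑ k ∈ Finset.range n, φ (X k ω)) - g (∫ x, φ x ∂ν)))
      atTop id (fun _ => P) (multivariateGaussian 0 (J * covarianceMatrix φ ν * Jᵀ)) := by
  have : IsProbabilityMeasure ν := (hX 0).isProbabilityMeasure_iff.1 inferInstance
  have hsqrt : Tendsto (fun n : ℕ => √(n : ℝ)) atTop atTop :=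
    Real.tendsto_sqrt_atTop.comp tendsto_natCast_atTop_atTop
  have haverage (n : ℕ) :
      AEMeasurable (fun ω => (n : ℝ)⁻¹ • ∑ k ∈ Finset.range n, φ (X k ω)) P := by
    refine .fun_const_smul (Finset.aemeasurable_fun_sum _ fun k _ => ?_) _
    exact hφ.comp_aemeasurable (hX k).aemeasurable
  refine tendstoInDistribution_of_identDistrib_limit
    (tendstoInDistribution_smul_comp_sub hsqrt haverage
      (tendstoInDistribution_sqrt_smul_average_sub hX hindep hφ hφ2) hg hg')
    ⟨by fun_prop, by fun_prop, ?_⟩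
  rw [Measure.map_id]
  exact (map_toLpLin_multivariateGaussian (posSemidef_covarianceMatrix hφ2) 0 J).trans
    (by rw [map_zero])

end MethodOfMoments

section GaussianMoments

open scoped NNReal

theorem integrable_pow_gaussianReal (v : ℝ≥0) (n : ℕ) :
    Integrable (fun x : ℝ => x ^ n) (gaussianReal 0 v) := by
  refine (integrable_norm_iff (by fun_prop)).1 ?_
  simpa only [id_eq, ← norm_pow] using
    (memLp_id_gaussianReal (μ := 0) (v := v) n).integrable_norm_pow'

theorem integrable_pow_mul_gaussianPDFReal (v : ℝ≥0) (n : ℕ) :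
    Integrable (fun x : ℝ => x ^ n * gaussianPDFReal 0 v x) := by
  rcases eq_or_ne v 0 with rfl | hv
  · simp
  · have h := integrable_pow_gaussianReal v n
    rw [gaussianReal_of_var_ne_zero _ hv, integrable_withDensity_iff_integrable_smul'
      (measurable_gaussianPDF _ _) (ae_of_all _ fun _ => gaussianPDF_lt_top)] at h
    simpa [toReal_gaussianPDF, mul_comm] using h

theorem hasDerivAt_gaussianPDFReal (μ : ℝ) (v : ℝ≥0) (x : ℝ) :
    HasDerivAt (gaussianPDFReal μ v) (-((x - μ) / v * gaussianPDFReal μ v x)) x := by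
  have h : HasDerivAt (fun y : ℝ => -(y - μ) ^ 2 / (2 * (v : ℝ))) (-((x - μ) / v)) x := by
    convert! ((((hasDerivAt_id x).sub_const μ).pow 2).neg).div_const (2 * (v : ℝ)) using 1
    simp only [id_eq, Nat.cast_ofNat, Nat.add_one_sub_one, pow_one, mul_one]
    rw [neg_div, mul_div_mul_left _ _ two_ne_zero]
  rw [gaussianPDFReal_def]
  convert! h.exp.const_mul (√(2 * Real.pi * (v : ℝ)))⁻¹ using 1
  ring

/-- Stein's identity `v * 𝔼[f'(Z)] = 𝔼[Z * f(Z)]` for monomials `f`. -/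
theorem integral_pow_add_two_gaussianReal (v : ℝ≥0) (n : ℕ) :
    ∫ x, x ^ (n + 2) ∂gaussianReal 0 v = v * (n + 1) * ∫ x, x ^ n ∂gaussianReal 0 v := by
  rcases eq_or_ne v 0 with rfl | hv
  · simp
  have hv' : (v : ℝ) ≠ 0 := by exact_mod_cast hv
  have hint (k : ℕ) (c : ℝ) : Integrable fun x : ℝ => c * (x ^ k * gaussianPDFReal 0 v x) :=
    (integrable_pow_mul_gaussianPDFReal v k).const_mul c
  have hparts := integral_mul_deriv_eq_deriv_mul_of_integrable
    (u := fun x : ℝ => x ^ (n + 1)) (u' := fun x => (n + 1) * x ^ n)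
    (v := gaussianPDFReal 0 v) (v' := fun x => -((x - 0) / v * gaussianPDFReal 0 v x))
    (fun x _ => by simpa using hasDerivAt_pow (n + 1) x)
    (fun x _ => hasDerivAt_gaussianPDFReal 0 v x)
    ((hint (n + 2) (-(v : ℝ)⁻¹)).congr (ae_of_all _ fun x => by simp only [Pi.mul_apply]; ring))
    ((hint n (n + 1)).congr (ae_of_all _ fun x => by simp only [Pi.mul_apply]; ring))
    (integrable_pow_mul_gaussianPDFReal v (n + 1))
  simp only [integral_gaussianReal_eq_integral_smul hv, smul_eq_mul]
  calc ∫ x, gaussianPDFReal 0 v x * x ^ (n + 2)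
      = -(v * ∫ x, x ^ (n + 1) * -((x - 0) / v * gaussianPDFReal 0 v x)) := by
        rw [← integral_const_mul, ← integral_neg]
        congr with x
        field_simp
        ring
    _ = v * ∫ x, (n + 1) * x ^ n * gaussianPDFReal 0 v x := by rw [hparts, mul_neg, neg_neg]
    _ = v * (n + 1) * ∫ x, gaussianPDFReal 0 v x * x ^ n := by
        rw [mul_assoc, ← integral_const_mul (n + 1 : ℝ)]
        congr with x
        ring

theorem integral_pow_gaussianReal_of_odd (v : ℝ≥0) {n : ℕ} (hn : Odd n) :
    ∫ x, x ^ n ∂gaussianReal 0 v = 0 := by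
  have h : ∫ x, x ^ n ∂gaussianReal 0 v = -∫ x, x ^ n ∂gaussianReal 0 v := by
    nth_rw 1 [← neg_zero, ← gaussianReal_map_neg]
    rw [integral_map (by fun_prop) (by fun_prop), ← integral_neg]
    simp only [hn.neg_pow]
  linarith

open scoped Nat in
theorem integral_pow_two_mul_gaussianReal (v : ℝ≥0) (k : ℕ) :
    ∫ x, x ^ (2 * k) ∂gaussianReal 0 v = v ^ k * (2 * k - 1)‼ := by
  induction k with
  | zero => simp
  | succ k ih =>
    rw [mul_add_one, integral_pow_add_two_gaussianReal, ih, Nat.add_succ_sub_one,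
      Nat.doubleFactorial_add_one]
    push_cast
    ring

end GaussianMoments

section GammaMoments

variable {a r s : ℝ}

theorem measurable_gammaPDF (a r : ℝ) : Measurable (gammaPDF a r) :=
  (measurable_gammaPDFReal a r).ennreal_ofReal

theorem ae_nonneg_gammaMeasure (a r : ℝ) : ∀ᵐ x ∂gammaMeasure a r, 0 ≤ x := by
  rw [gammaMeasure, ae_withDensity_iff (measurable_gammaPDF a r)]
  exact ae_of_all _ fun x hx => le_of_not_gt fun h => hx (gammaPDF_of_neg h)

theorem integrable_gammaPDFReal (ha : 0 < a) (hr : 0 < r) : Integrable (gammaPDFReal a r) := by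
  refine ⟨by fun_prop, ?_⟩
  rw [hasFiniteIntegral_iff_ofReal (ae_of_all _ (gammaPDFReal_nonneg ha hr))]
  exact (lintegral_gammaPDF_eq_one ha hr).trans_lt ENNReal.one_lt_top

theorem integral_gammaPDFReal_eq_one (ha : 0 < a) (hr : 0 < r) :
    ∫ x, gammaPDFReal a r x = 1 := by
  rw [integral_eq_lintegral_of_nonneg_ae (ae_of_all _ (gammaPDFReal_nonneg ha hr)) (by fun_prop)]
  exact congrArg ENNReal.toReal (lintegral_gammaPDF_eq_one ha hr)

theorem gammaPDFReal_mul_rpow (hs : 0 < a + s) (hr : 0 < r) {x : ℝ} (hx : x ≠ 0) :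
    gammaPDFReal a r x * x ^ s =
      Real.Gamma (a + s) / (Real.Gamma a * r ^ s) * gammaPDFReal (a + s) r x := by
  rcases hx.lt_or_gt with hx | hx
  · simp [gammaPDFReal, hx.not_ge]
  · have hΓ : Real.Gamma (a + s) ≠ 0 := (Real.Gamma_pos_of_pos hs).ne'
    have hrs : r ^ s ≠ 0 := (Real.rpow_pos_of_pos hr s).ne'
    simp only [gammaPDFReal, if_pos hx.le, add_sub_right_comm a s 1, Real.rpow_add hx,
      Real.rpow_add hr]
    field_simp

theorem gammaPDFReal_mul_rpow_ae_eq (hs : 0 < a + s) (hr : 0 < r) :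
    (fun x => gammaPDFReal a r x * x ^ s) =ᵐ[volume]
      fun x => Real.Gamma (a + s) / (Real.Gamma a * r ^ s) * gammaPDFReal (a + s) r x := by
  filter_upwards [Measure.ae_ne volume 0] with x hx using gammaPDFReal_mul_rpow hs hr hx

theorem integrable_rpow_gammaMeasure (ha : 0 < a) (hr : 0 < r) (hs : 0 < a + s) :
    Integrable (fun x => x ^ s) (gammaMeasure a r) := by
  rw [gammaMeasure, integrable_withDensity_iff_integrable_smul' (measurable_gammaPDF a r)
    (ae_of_all _ fun _ => ENNReal.ofReal_lt_top)]
  simp only [gammaPDF, ENNReal.toReal_ofReal (gammaPDFReal_nonneg ha hr _), smul_eq_mul]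
  exact ((integrable_gammaPDFReal hs hr).const_mul _).congr
    (gammaPDFReal_mul_rpow_ae_eq hs hr).symm

theorem integral_rpow_gammaMeasure (ha : 0 < a) (hr : 0 < r) (hs : 0 < a + s) :
    ∫ x, x ^ s ∂gammaMeasure a r = Real.Gamma (a + s) / (Real.Gamma a * r ^ s) := by
  rw [gammaMeasure, integral_withDensity_eq_integral_toReal_smul (measurable_gammaPDF a r)
    (ae_of_all _ fun _ => ENNReal.ofReal_lt_top)]
  simp only [gammaPDF, ENNReal.toReal_ofReal (gammaPDFReal_nonneg ha hr _), smul_eq_mul]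
  rw [integral_congr_ae (gammaPDFReal_mul_rpow_ae_eq hs hr), integral_const_mul,
    integral_gammaPDFReal_eq_one hs hr, mul_one]

theorem gamma_add_natCast (ha : 0 < a) (n : ℕ) :
    Real.Gamma (a + n) = (ascPochhammer ℝ n).eval a * Real.Gamma a := by
  induction n with
  | zero => simp
  | succ n ih =>
    rw [Nat.cast_add_one, ← add_assoc, Real.Gamma_add_one (by positivity), ih,
      ascPochhammer_succ_eval]
    ring

theorem integral_pow_gammaMeasure (ha : 0 < a) (hr : 0 < r) (n : ℕ) :
    ∫ x, x ^ n ∂gammaMeasure a r = (ascPochhammer ℝ n).eval a / r ^ n := by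
  have h := integral_rpow_gammaMeasure ha hr (s := n) (by positivity)
  simp only [Real.rpow_natCast, gamma_add_natCast ha] at h
  rw [h, mul_comm, mul_div_mul_left _ _ (Real.Gamma_pos_of_pos ha).ne']

end GammaMoments

section MomentCurve

/-- The moment curve `t ↦ (t, t ^ 2, …, t ^ d)`, whose average under a law is the vector of the
first `d` moments; coordinate `i : Fin d` holds the power `i + 1`. -/
noncomputable def momentCurve (d : ℕ) (t : ℝ) : EuclideanSpace ℝ (Fin d) :=
  WithLp.toLp 2 fun i => t ^ ((i : ℕ) + 1)

theorem momentCurve_apply (d : ℕ) (t : ℝ) (i : Fin d) : momentCurve d t i = t ^ ((i : ℕ) + 1) :=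
  rfl

@[fun_prop]
theorem measurable_momentCurve (d : ℕ) : Measurable (momentCurve d) := by
  unfold momentCurve
  fun_prop

variable {Ω : Type*} {mΩ : MeasurableSpace Ω} {P : Measure Ω} {Y : Ω → ℝ} {d : ℕ}

theorem memLp_two_momentCurve (hYm : AEMeasurable Y P)
    (hY : ∀ n, Integrable (fun ω => Y ω ^ n) P) : MemLp (fun ω => momentCurve d (Y ω)) 2 P :=
  MemLp.of_eval_piLp fun i => by
    simp only [momentCurve_apply]
    rw [memLp_two_iff_integrable_sq (by fun_prop)]
    simpa only [← pow_mul] using hY (((i : ℕ) + 1) * 2)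

theorem integral_momentCurve_apply (hY : ∀ n, Integrable (fun ω => Y ω ^ n) P) (i : Fin d) :
    (∫ ω, momentCurve d (Y ω) ∂P) i = ∫ ω, Y ω ^ ((i : ℕ) + 1) ∂P :=
  eval_integral_piLp (f := fun ω => momentCurve d (Y ω)) (fun i => hY ((i : ℕ) + 1)) i

theorem covarianceMatrix_momentCurve_apply [IsProbabilityMeasure P]
    (h : MemLp (fun ω => momentCurve d (Y ω)) 2 P) (i j : Fin d) :
    covarianceMatrix (fun ω => momentCurve d (Y ω)) P i j =
      ∫ ω, Y ω ^ ((i : ℕ) + 1 + (j + 1)) ∂P -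
        (∫ ω, Y ω ^ ((i : ℕ) + 1) ∂P) * ∫ ω, Y ω ^ ((j : ℕ) + 1) ∂P := by
  rw [covarianceMatrix_apply, covariance_eq_sub (h.eval_piLp i) (h.eval_piLp j)]
  simp only [Pi.mul_apply, momentCurve_apply, pow_add]

end MomentCurve

namespace SVG

section Moments

variable {a b : ℝ}

theorem isProbabilityMeasure_law (ha : 0 < a) (m b : ℝ) : IsProbabilityMeasure (law m a b) := by
  have := isProbabilityMeasure_gammaMeasure ha one_pos
  exact Measure.isProbabilityMeasure_map (by fun_prop)

theorem integrable_sqrt_mul_pow_gammaMeasure (ha : 0 < a) (hb : 0 ≤ b) {r : ℝ} (hr : 0 < r)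
    (n : ℕ) : Integrable (fun g => √(b * g) ^ n) (gammaMeasure a r) := by
  refine ((integrable_rpow_gammaMeasure ha hr (s := (n : ℝ) / 2) (by positivity)).const_mul
    (b ^ ((n : ℝ) / 2))).congr ?_
  filter_upwards [ae_nonneg_gammaMeasure a r] with g hg
  rw [← Real.mul_rpow hb hg, Real.sqrt_eq_rpow, ← Real.rpow_mul_natCast (by positivity),
    one_div_mul_eq_div]

theorem integrable_sub_pow_law (ha : 0 < a) (hb : 0 ≤ b) (m : ℝ) (n : ℕ) :
    Integrable (fun x => (x - m) ^ n) (law m a b) := by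
  have := isProbabilityMeasure_gammaMeasure ha one_pos
  rw [law, integrable_map_measure (by fun_prop) (by fun_prop)]
  simpa only [Function.comp_def, add_sub_cancel_left, mul_pow] using
    (integrable_sqrt_mul_pow_gammaMeasure ha hb one_pos n).mul_prod
      (integrable_pow_gaussianReal 1 n)

theorem integral_sub_pow_law (ha : 0 < a) (m b : ℝ) (n : ℕ) :
    ∫ x, (x - m) ^ n ∂law m a b =
      (∫ g, √(b * g) ^ n ∂gammaMeasure a 1) * ∫ z, z ^ n ∂gaussianReal 0 1 := by
  have := isProbabilityMeasure_gammaMeasure ha one_pos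
  rw [law, integral_map (by fun_prop) (by fun_prop), ← integral_prod_mul]
  simp only [add_sub_cancel_left, mul_pow]

theorem integral_sub_pow_law_of_odd (ha : 0 < a) (m b : ℝ) {n : ℕ} (hn : Odd n) :
    ∫ x, (x - m) ^ n ∂law m a b = 0 := by
  rw [integral_sub_pow_law ha, integral_pow_gaussianReal_of_odd 1 hn, mul_zero]

open scoped Nat in
theorem integral_sub_pow_two_mul_law (ha : 0 < a) (hb : 0 ≤ b) (m : ℝ) (k : ℕ) :
    ∫ x, (x - m) ^ (2 * k) ∂law m a b =
      b ^ k * (ascPochhammer ℝ k).eval a * (2 * k - 1)‼ := by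
  have hgamma : ∫ g, √(b * g) ^ (2 * k) ∂gammaMeasure a 1 =
      b ^ k * (ascPochhammer ℝ k).eval a := by
    have hsqrt : (fun g => √(b * g) ^ (2 * k)) =ᵐ[gammaMeasure a 1] fun g => b ^ k * g ^ k := by
      filter_upwards [ae_nonneg_gammaMeasure a 1] with g hg
      rw [pow_mul, Real.sq_sqrt (mul_nonneg hb hg), mul_pow]
    rw [integral_congr_ae hsqrt, integral_const_mul, integral_pow_gammaMeasure ha one_pos,
      one_pow, div_one]
  rw [integral_sub_pow_law ha, hgamma, integral_pow_two_mul_gaussianReal, NNReal.coe_one,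
    one_pow, one_mul]

theorem memLp_two_momentCurve_law (ha : 0 < a) (hb : 0 ≤ b) (m : ℝ) (d : ℕ) :
    MemLp (fun x => momentCurve d (x - m)) 2 (law m a b) :=
  memLp_two_momentCurve (by fun_prop) (integrable_sub_pow_law ha hb m)

theorem integral_sub_sq_law (ha : 0 < a) (hb : 0 ≤ b) (m : ℝ) :
    ∫ x, (x - m) ^ 2 ∂law m a b = a * b :=
  (integral_sub_pow_two_mul_law ha hb m 1).trans (by simp [mul_comm])

theorem integral_sub_pow_four_law (ha : 0 < a) (hb : 0 ≤ b) (m : ℝ) :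
    ∫ x, (x - m) ^ 4 ∂law m a b = 3 * a * (a + 1) * b ^ 2 :=
  (integral_sub_pow_two_mul_law ha hb m 2).trans (by
    simp only [ascPochhammer_succ_eval, ascPochhammer_one, Polynomial.eval_X, Nat.doubleFactorial]
    push_cast
    ring)

theorem integral_sub_pow_six_law (ha : 0 < a) (hb : 0 ≤ b) (m : ℝ) :
    ∫ x, (x - m) ^ 6 ∂law m a b = 15 * a * (a + 1) * (a + 2) * b ^ 3 :=
  (integral_sub_pow_two_mul_law ha hb m 3).trans (by
    simp only [ascPochhammer_succ_eval, ascPochhammer_one, Polynomial.eval_X, Nat.doubleFactorial]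
    push_cast
    ring)

theorem integral_sub_pow_eight_law (ha : 0 < a) (hb : 0 ≤ b) (m : ℝ) :
    ∫ x, (x - m) ^ 8 ∂law m a b = 105 * a * (a + 1) * (a + 2) * (a + 3) * b ^ 4 :=
  (integral_sub_pow_two_mul_law ha hb m 4).trans (by
    simp only [ascPochhammer_succ_eval, ascPochhammer_one, Polynomial.eval_X, Nat.doubleFactorial]
    push_cast
    ring)

/-- The first four moments about `m` of the symmetric variance-gamma law. -/
noncomputable def momentVector (a b : ℝ) : EuclideanSpace ℝ (Fin 4) :=
  !₂[0, a * b, 0, 3 * a * (a + 1) * b ^ 2]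

theorem integral_momentCurve_law (ha : 0 < a) (hb : 0 ≤ b) (m : ℝ) :
    ∫ x, momentCurve 4 (x - m) ∂law m a b = momentVector a b := by
  ext i
  rw [integral_momentCurve_apply (integrable_sub_pow_law ha hb m)]
  fin_cases i
  · exact integral_sub_pow_law_of_odd ha m b odd_one
  · exact integral_sub_sq_law ha hb m
  · exact integral_sub_pow_law_of_odd ha m b (by decide)
  · exact integral_sub_pow_four_law ha hb m

theorem covarianceMatrix_momentCurve_law (ha : 0 < a) (hb : 0 ≤ b) (m : ℝ) :
    covarianceMatrix (fun x => momentCurve 4 (x - m)) (law m a b) =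
      !![a * b, 0, 3 * a * (a + 1) * b ^ 2, 0;
         0, a * (2 * a + 3) * b ^ 2, 0, 6 * a * (a + 1) * (2 * a + 5) * b ^ 3;
         3 * a * (a + 1) * b ^ 2, 0, 15 * a * (a + 1) * (a + 2) * b ^ 3, 0;
         0, 6 * a * (a + 1) * (2 * a + 5) * b ^ 3, 0,
          6 * a * (a + 1) * (16 * a ^ 2 + 86 * a + 105) * b ^ 4] := by
  have := isProbabilityMeasure_law ha m b
  have hodd (n : ℕ) (hn : Odd n) := integral_sub_pow_law_of_odd ha m b hn
  have h1 : ∫ x, x - m ∂law m a b = 0 := by simpa only [pow_one] using hodd 1 odd_one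
  have h3 := hodd 3 (by decide)
  have h5 := hodd 5 (by decide)
  have h7 := hodd 7 (by decide)
  ext i j
  rw [covarianceMatrix_momentCurve_apply (memLp_two_momentCurve_law ha hb m 4)]
  fin_cases i <;> fin_cases j <;>
    simp [h1, h3, h5, h7, integral_sub_sq_law ha hb, integral_sub_pow_four_law ha hb,
      integral_sub_pow_six_law ha hb, integral_sub_pow_eight_law ha hb] <;> ring

end Moments

section MomentEstimator

/-- The shape parameter as a function of the centered moments `v` and `k` of orders two and
four. -/
noncomputable def shape (v k : ℝ) : ℝ := 3 * v ^ 2 / (k - 3 * v ^ 2)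

/-- The scale parameter as a function of the centered moments `v` and `k` of orders two and
four. -/
noncomputable def scale (v k : ℝ) : ℝ := k / (3 * v) - v

/-- The centered moment of order two in terms of the moments `y i` of order `i + 1` about an
arbitrary point. -/
noncomputable def centeredSecond (y : EuclideanSpace ℝ (Fin 4)) : ℝ := y 1 - y 0 ^ 2

/-- The centered moment of order four in terms of the moments `y i` of order `i + 1` about an
arbitrary point. -/
noncomputable def centeredFourth (y : EuclideanSpace ℝ (Fin 4)) : ℝ :=
  y 3 - 4 * y 0 * y 2 + 6 * y 0 ^ 2 * y 1 - 3 * y 0 ^ 4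

/-- Location, shape and scale as functions of the first four moments `y` about the point `m`. -/
noncomputable def momentEstimator (m : ℝ) (y : EuclideanSpace ℝ (Fin 4)) :
    EuclideanSpace ℝ (Fin 3) :=
  !₂[m + y 0, shape (centeredSecond y) (centeredFourth y),
    scale (centeredSecond y) (centeredFourth y)]

theorem measurable_momentEstimator (m : ℝ) : Measurable (momentEstimator m) := by
  have hV : Measurable centeredSecond := by unfold centeredSecond; fun_prop
  have hK : Measurable centeredFourth := by unfold centeredFourth; fun_prop
  refine (WithLp.measurable_toLp 2 _).comp (measurable_pi_lambda _ fun i => ?_)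
  fin_cases i
  · exact (by fun_prop : Measurable fun y : EuclideanSpace ℝ (Fin 4) => m + y 0)
  · exact ((hV.pow_const 2).const_mul 3).div (hK.sub ((hV.pow_const 2).const_mul 3))
  · exact (hK.div (hV.const_mul 3)).sub hV

section Empirical

variable (x : ℕ → ℝ) (m : ℝ) {N : ℕ}

theorem average_momentCurve_apply (d N : ℕ) (i : Fin d) :
    ((N : ℝ)⁻¹ • ∑ k ∈ Finset.range N, momentCurve d (x k - m)) i =
      (∑ k ∈ Finset.range N, (x k - m) ^ ((i : ℕ) + 1)) / N := by
  simp [momentCurve_apply, div_eq_inv_mul]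

theorem mean_eq_add (hN : N ≠ 0) :
    mean x N = m + (∑ k ∈ Finset.range N, (x k - m)) / N := by
  have hN' : (N : ℝ) ≠ 0 := by exact_mod_cast hN
  rw [Finset.sum_sub_distrib, Finset.sum_const, Finset.card_range, nsmul_eq_mul, mean]
  field_simp
  ring

theorem vHat_eq_centeredSecond (hN : N ≠ 0) :
    vHat x N =
      centeredSecond ((N : ℝ)⁻¹ • ∑ k ∈ Finset.range N, momentCurve 4 (x k - m)) := by
  have hexpand (k : ℕ) (c : ℝ) : (x k - (m + c)) ^ 2 =
      (x k - m) ^ 2 + (-2 * c) * (x k - m) + c ^ 2 := by ring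
  simp only [vHat, centeredSecond, average_momentCurve_apply, mean_eq_add x m hN, hexpand,
    Finset.sum_add_distrib, ← Finset.mul_sum, Finset.sum_const, Finset.card_range, nsmul_eq_mul,
    Fin.val_zero, Fin.val_one, zero_add, pow_one, Nat.reduceAdd]
  field_simp
  ring

theorem kHat_eq_centeredFourth (hN : N ≠ 0) :
    kHat x N =
      centeredFourth ((N : ℝ)⁻¹ • ∑ k ∈ Finset.range N, momentCurve 4 (x k - m)) := by
  have hexpand (k : ℕ) (c : ℝ) : (x k - (m + c)) ^ 4 = (x k - m) ^ 4 + (-4 * c) * (x k - m) ^ 3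
      + 6 * c ^ 2 * (x k - m) ^ 2 + (-4 * c ^ 3) * (x k - m) + c ^ 4 := by ring
  simp only [kHat, centeredFourth, average_momentCurve_apply, mean_eq_add x m hN, hexpand,
    Finset.sum_add_distrib, ← Finset.mul_sum, Finset.sum_const, Finset.card_range, nsmul_eq_mul,
    Fin.val_zero, Fin.val_one, Fin.val_two, show ((3 : Fin 4) : ℕ) = 3 from rfl,
    zero_add, pow_one, Nat.reduceAdd]
  field_simp
  ring

theorem momentEstimator_average (hN : N ≠ 0) :
    momentEstimator m ((N : ℝ)⁻¹ • ∑ k ∈ Finset.range N, momentCurve 4 (x k - m)) =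
      !₂[mean x N, aHat x N, bHat x N] := by
  rw [momentEstimator, ← vHat_eq_centeredSecond x m hN, ← kHat_eq_centeredFourth x m hN,
    average_momentCurve_apply, mean_eq_add x m hN]
  simp only [Fin.val_zero, zero_add, pow_one]
  rfl

end Empirical

variable {a b : ℝ}

theorem centeredSecond_momentVector (a b : ℝ) : centeredSecond (momentVector a b) = a * b := by
  simp [centeredSecond, momentVector]

theorem centeredFourth_momentVector (a b : ℝ) :
    centeredFourth (momentVector a b) = 3 * a * (a + 1) * b ^ 2 := by
  simp [centeredFourth, momentVector]

theorem momentEstimator_momentVector (m : ℝ) (ha : a ≠ 0) (hb : b ≠ 0) :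
    momentEstimator m (momentVector a b) = !₂[m, a, b] := by
  have hshape : shape (a * b) (3 * a * (a + 1) * b ^ 2) = a := by
    have hden : 3 * a * (a + 1) * b ^ 2 - 3 * (a * b) ^ 2 = 3 * a * b ^ 2 := by ring
    rw [shape, hden]
    field_simp
  have hscale : scale (a * b) (3 * a * (a + 1) * b ^ 2) = b := by
    rw [scale]
    field_simp
    ring
  rw [momentEstimator, centeredSecond_momentVector, centeredFourth_momentVector, hshape, hscale]
  simp [momentVector]

section Derivative

variable {E : Type*} [NormedAddCommGroup E] [NormedSpace ℝ E] {y : E}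

theorem hasFDerivAt_div {f g : E → ℝ} {f' g' : E →L[ℝ] ℝ} (hf : HasFDerivAt f f' y)
    (hg : HasFDerivAt g g' y) (hy : g y ≠ 0) :
    HasFDerivAt (fun z => f z / g z) ((g y)⁻¹ • f' - (f y / g y ^ 2) • g') y := by
  simp only [div_eq_mul_inv]
  convert! hf.mul ((hasDerivAt_inv hy).comp_hasFDerivAt y hg) using 1
  ext v
  simp only [sub_apply, smul_apply, smul_eq_mul, neg_smul, smul_neg, Function.comp_apply,
    add_apply, neg_apply]
  ring

variable {V K : E → ℝ} {V' K' : E →L[ℝ] ℝ}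

theorem hasFDerivAt_shape (hV : HasFDerivAt V V' y) (hK : HasFDerivAt K K' y)
    (ha : a ≠ 0) (hb : b ≠ 0) (hVy : V y = a * b) (hKy : K y = 3 * a * (a + 1) * b ^ 2) :
    HasFDerivAt (fun z => shape (V z) (K z))
      ((2 * (1 + a) / b) • V' + (-1 / (3 * b ^ 2)) • K') y := by
  have hden : 3 * a * (a + 1) * b ^ 2 - 3 * (a * b) ^ 2 = 3 * a * b ^ 2 := by ring
  have hden0 : K y - 3 * V y ^ 2 ≠ 0 := by rw [hVy, hKy, hden]; positivity
  unfold shape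
  convert! hasFDerivAt_div ((hV.pow 2).const_mul 3) (hK.sub ((hV.pow 2).const_mul 3)) hden0 using 1
  ext v
  simp only [add_apply, sub_apply, smul_apply, smul_eq_mul, nsmul_eq_mul, Pi.sub_apply, hVy, hKy,
    hden, Nat.add_one_sub_one, pow_one, Nat.cast_ofNat]
  field_simp
  ring

theorem hasFDerivAt_scale (hV : HasFDerivAt V V' y) (hK : HasFDerivAt K K' y)
    (ha : a ≠ 0) (hb : b ≠ 0) (hVy : V y = a * b) (hKy : K y = 3 * a * (a + 1) * b ^ 2) :
    HasFDerivAt (fun z => scale (V z) (K z))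
      ((-(2 * a + 1) / a) • V' + (1 / (3 * a * b)) • K') y := by
  have hden0 : 3 * V y ≠ 0 := by rw [hVy]; positivity
  unfold scale
  convert! (hasFDerivAt_div hK (hV.const_mul 3) hden0).sub hV using 1
  ext v
  simp only [add_apply, sub_apply, smul_apply, smul_eq_mul, hVy, hKy]
  field_simp
  ring

end Derivative

-- Only the linear terms below contribute, because the odd moments vanish at `momentVector a b`.
theorem hasFDerivAt_centeredSecond (a b : ℝ) :
    HasFDerivAt centeredSecond (EuclideanSpace.proj 1 : EuclideanSpace ℝ (Fin 4) →L[ℝ] ℝ)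
      (momentVector a b) := by
  have h (i : Fin 4) := PiLp.hasFDerivAt_apply (𝕜 := ℝ) 2 (momentVector a b) i
  convert! (h 1).sub ((h 0).pow 2) using 1
  ext v
  simp [momentVector]

theorem hasFDerivAt_centeredFourth (a b : ℝ) :
    HasFDerivAt centeredFourth (EuclideanSpace.proj 3 : EuclideanSpace ℝ (Fin 4) →L[ℝ] ℝ)
      (momentVector a b) := by
  have h (i : Fin 4) := PiLp.hasFDerivAt_apply (𝕜 := ℝ) 2 (momentVector a b) i
  convert! (((h 3).sub (((h 0).const_mul 4).mul (h 2))).add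
    ((((h 0).pow 2).const_mul 6).mul (h 1))).sub (((h 0).pow 4).const_mul 3) using 1
  ext v
  simp [momentVector]

/-- The Jacobian matrix of `momentEstimator` at `momentVector a b`. -/
noncomputable def jacobian (a b : ℝ) : Matrix (Fin 3) (Fin 4) ℝ :=
  !![1, 0, 0, 0;
     0, 2 * (1 + a) / b, 0, -1 / (3 * b ^ 2);
     0, -(2 * a + 1) / a, 0, 1 / (3 * a * b)]

theorem hasFDerivAt_momentEstimator (m : ℝ) (ha : a ≠ 0) (hb : b ≠ 0) :
    HasFDerivAt (momentEstimator m) (Matrix.toLpLin 2 2 (jacobian a b)).toContinuousLinearMap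
      (momentVector a b) := by
  have hV := hasFDerivAt_centeredSecond a b
  have hK := hasFDerivAt_centeredFourth a b
  have hVy := centeredSecond_momentVector a b
  have hKy := centeredFourth_momentVector a b
  have hrow (i : Fin 3) (v : EuclideanSpace ℝ (Fin 4)) :
      Matrix.toLpLin 2 2 (jacobian a b) v i = ∑ j, jacobian a b i j * v j := rfl
  rw [← hasFDerivWithinAt_univ, hasFDerivWithinAt_euclidean]
  intro i
  rw [hasFDerivWithinAt_univ]
  fin_cases i
  · refine ((PiLp.hasFDerivAt_apply (𝕜 := ℝ) 2 (momentVector a b) 0).const_add m).congr_fderiv ?_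
    ext v
    refine .trans ?_ (hrow 0 v).symm
    simp [Fin.sum_univ_four, jacobian]
  · refine (hasFDerivAt_shape hV hK ha hb hVy hKy).congr_fderiv ?_
    ext v
    refine .trans ?_ (hrow 1 v).symm
    simp [Fin.sum_univ_four, jacobian]
  · refine (hasFDerivAt_scale hV hK ha hb hVy hKy).congr_fderiv ?_
    ext v
    refine .trans ?_ (hrow 2 v).symm
    simp [Fin.sum_univ_four, jacobian]

theorem jacobian_mul_covarianceMatrix_mul_transpose (ha : 0 < a) (hb : 0 < b) (m : ℝ) :
    jacobian a b * covarianceMatrix (fun x => momentCurve 4 (x - m)) (law m a b) *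
      (jacobian a b)ᵀ = limitCov a b := by
  rw [covarianceMatrix_momentCurve_law ha hb.le]
  ext i j
  simp only [Matrix.mul_apply, Fin.sum_univ_four, Matrix.transpose_apply]
  fin_cases i <;> fin_cases j <;> simp [jacobian, limitCov, sigma] <;> field

end MomentEstimator

end SVG

theorem theorem4 {Ω : Type*} [MeasurableSpace Ω] (P : Measure Ω) [IsProbabilityMeasure P]
    (m a b : ℝ) (ha : 0 < a) (hb : 0 < b)
    (X : ℕ → Ω → ℝ) (hlaw : ∀ i, HasLaw (X i) (SVG.law m a b) P) (hindep : iIndepFun X P) :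
    (SVG.limitCov a b).PosSemidef ∧
      TendstoInDistribution
        (fun (N : ℕ) (ω : Ω) => √(N : ℝ) •
          (!₂[SVG.mean (fun i => X i ω) N, SVG.aHat (fun i => X i ω) N,
              SVG.bHat (fun i => X i ω) N] - !₂[m, a, b] : EuclideanSpace ℝ (Fin 3)))
        atTop (id : EuclideanSpace ℝ (Fin 3) → EuclideanSpace ℝ (Fin 3)) (fun _ => P)
        (multivariateGaussian 0 (SVG.limitCov a b)) := by
  have := SVG.isProbabilityMeasure_law ha m b
  have hmem := SVG.memLp_two_momentCurve_law ha hb.le m 4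
  have hcov := SVG.jacobian_mul_covarianceMatrix_mul_transpose ha hb m
  have hmean := SVG.integral_momentCurve_law ha hb.le m
  have hderiv := SVG.hasFDerivAt_momentEstimator m ha.ne' hb.ne'
  constructor
  · simpa [hcov] using
      (posSemidef_covarianceMatrix hmem).mul_mul_conjTranspose_same (SVG.jacobian a b)
  · have hlim := tendstoInDistribution_sqrt_smul_comp_average_sub hlaw hindep (by fun_prop) hmem
      (SVG.measurable_momentEstimator m) (hmean ▸ hderiv)
    rw [hcov] at hlim
    refine hlim.congr (fun N => ae_of_all _ fun ω => ?_) .rfl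
    rcases eq_or_ne N 0 with rfl | hN
    · simp
    · simp only [hmean, SVG.momentEstimator_momentVector m ha.ne' hb.ne',
        ← SVG.momentEstimator_average (fun i => X i ω) m hN]
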